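/- Let $\sigma_w,\gamma_w>0$ and $\sigma_b,\gamma_b\ge 0$ be real hyperparameters. For $k\ge 0$ let $h_k(x)=\frac{(-1)^k e^{x^2/2}}{\sqrt{k!}}\frac{d^k}{dx^k}e^{-x^2/2}$ be the normalized probabilist's Hermite polynomials, and let $\mu_k(\psi)=\mathbb{E}_{X\sim\mathcal N(0,1)}[\psi(X)h_k(X)]$ be the $k$-th Hermite coefficient of $\psi$. For an activation function $\phi:\mathbb R\to\mathbb R$, differentiable almost everywhere with derivative $\phi'$, the coefficients of the Neural Tangent Kernel (NTK) power series of a depth-two network with activation $\phi$ are, for $p\ge 0$, \[ \kappa_{p,2}=\alpha_{p,2}+\sum_{q=0}^{p}\kappa_{q,1}\,\upsilon_{p-q,2}, \] where \[ \kappa_{p,1}=\delta_{p=0}\gamma_b^2+\delta_{p=1}\gamma_w^2,\qquad \alpha_{p,2}=\sigma_w^2\mu_p^2(\phi)+\delta_{p=0}\sigma_b^2,\qquad \upsilon_{p,2}=\sigma_w^2\mu_p^2(\phi'). \] Let $\delta_{(p\text{ even})\cup(\gamma_b>0)}$ be $1$ if $p$ is even or $\gamma_b>0$, and $0$ otherwise.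 Then, as $p\to\infty$ with the activation and the hyperparameters fixed: 1. if $\phi(z)=\mathrm{ReLU}(z)=\max\{0,z\}$, then $\kappa_{p,2}=\delta_{(p\text{ even})\cup(\gamma_b>0)}\,\Theta(p^{-3/2})$; 2. if $\phi(z)=\tanh(z)$, then $\kappa_{p,2}=O\!\left(\exp\!\left(-\frac{\pi\sqrt{p-1}}{2}\right)\right)$; 3. for every $\sigma>0$, if $\phi(z)=\omega_\sigma(z)=\frac{1}{\sqrt{2\pi\sigma^2}}e^{-z^2/(2\sigma^2)}$, then $\kappa_{p,2}=\delta_{(p\text{ even})\cup(\gamma_b>0)}\,\Theta\!\left(p^{1/2}(\sigma^2+1)^{-p}\right)$. Here $\kappa_{p,2}=\delta_p\,\Theta(g(p))$ means that there are constants $0<c\le C$ and an index $P$ with $c\,\delta_p\,g(p)\le \kappa_{p,2}\le C\,\delta_p\,g(p)$ for all $p\ge P$; in particular $\kappa_{p,2}=0$ for all large $p$ with $\delta_p=0$. -/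

import Mathlib

open MeasureTheory ProbabilityTheory Filter Asymptotics

noncomputable section

namespace NTK

/-- The normalized probabilist's Hermite polynomial `h_k = H_k / √(k!)`, where `H_k` is Mathlib's
`Polynomial.hermite k`, that is `H_k(x) = (-1)^k e^{x²/2} (d/dx)^k e^{-x²/2}`
(see `Polynomial.hermite_eq_deriv_gaussian`). -/
def hermiteNormalized (k : ℕ) (x : ℝ) : ℝ :=
  Polynomial.aeval x (Polynomial.hermite k) / √(k.factorial : ℝ)

/-- The `k`-th normalized Hermite coefficient `μ_k(φ) = E[φ(X) h_k(X)]`, `X ∼ N(0,1)`. -/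
def hermiteCoeff (φ : ℝ → ℝ) (k : ℕ) : ℝ :=
  ∫ x, φ x * hermiteNormalized k x ∂(gaussianReal 0 1)

/-- `κ_{p,1} = δ_{p=0} γ_b² + δ_{p=1} γ_w²`. -/
def kappaOne (γw γb : ℝ) (p : ℕ) : ℝ :=
  (if p = 0 then γb ^ 2 else 0) + (if p = 1 then γw ^ 2 else 0)

/-- `α_{p,2} = σ_w² μ_p(φ)² + δ_{p=0} σ_b²`. -/
def alphaTwo (φ : ℝ → ℝ) (σw σb : ℝ) (p : ℕ) : ℝ :=
  σw ^ 2 * hermiteCoeff φ p ^ 2 + (if p = 0 then σb ^ 2 else 0)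

/-- `υ_{p,2} = σ_w² μ_p(φ')²`. The value of `deriv φ` at a point where `φ` is not differentiable
is irrelevant for activations that are differentiable almost everywhere. -/
def upsilonTwo (φ : ℝ → ℝ) (σw : ℝ) (p : ℕ) : ℝ :=
  σw ^ 2 * hermiteCoeff (deriv φ) p ^ 2

/-- The coefficients of the NTK power series of a depth-two network with activation `φ`:
`κ_{p,2} = α_{p,2} + ∑_{q=0}^p κ_{q,1} υ_{p-q,2}`. -/
def kappaTwo (φ : ℝ → ℝ) (σw σb γw γb : ℝ) (p : ℕ) : ℝ :=
  alphaTwo φ σw σb p + ∑ q ∈ Finset.range (p + 1), kappaOne γw γb q * upsilonTwo φ σw (p - q)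

/-- The ReLU activation. -/
def relu (z : ℝ) : ℝ := max 0 z

/-- The Gaussian activation `ω_σ`, the density of `N(0, σ²)`. -/
def gaussianActivation (σ z : ℝ) : ℝ :=
  1 / √(2 * Real.pi * σ ^ 2) * Real.exp (-z ^ 2 / (2 * σ ^ 2))

end NTK

end

/-! Gaussian integration by parts gives `μ_n(φ') = √(n+1) μ_{n+1}(φ)`, and only `q = 0, 1`
contribute to the convolution. Hence for `p ≥ 1`, `κ_{p,2} = σw² (μ_p² + γw² p μ_p² + γb² (p+1)
μ_{p+1}²)`, and everything reduces to the size of `n μ_n²` (`kappaTwo_succ`, `kappaTwo_isTheta`).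
For ReLU and the Gaussian, odd coefficients eventually vanish, so odd `p` see only the `γb` term;
this is the source of the indicator.

ReLU: `x H_{n+2} ρ`, with `ρ` the Gaussian density, has an explicit antiderivative, so `μ_{n+2} =
H_n(0) ρ(0) / √((n+2)!)`. Gaussian: `φ' = -x φ / σ²` turns integration by parts into a two-step
recursion for the moments. In both cases the even coefficients involve `((2m-1)‼)² / (2m)!`, which
is of order `m^(-1/2)`.

Tanh: expand in partial fractions with poles at `±i a_k`, `a_k = π(k + 1/2)`, and write each term as
a Laplace transform of `sin (t x)`. The Hermite moments of the sine are at most `t^n e^{-t²/2}`,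
which concentrates near `t = √n`, so the factor `e^{-a_k t}` yields decay exponential in `√n`.
Keeping only the rate `π/4 < a_0` suffices, since squaring gives `e^{-π√n/2}`; the spare rate makes
the sum over poles converge. -/

namespace NTK
open Polynomial Set

/-! ### Hermite recurrences and Gaussian integration by parts. -/

/-- The probabilist's Hermite polynomial as a function on the reals. -/
noncomputable abbrev hermiteFun (n : ℕ) (x : ℝ) : ℝ := aeval x (hermite n)

/-- The density of the standard Gaussian. -/
noncomputable abbrev stdGaussian (x : ℝ) : ℝ := gaussianPDFReal 0 1 x

theorem derivative_hermite_succ (n : ℕ) :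
    derivative (hermite (n + 1)) = (n + 1 : ℤ[X]) * hermite n := by
  induction n with
  | zero => simp
  | succ n ih =>
    rw [hermite_succ (n + 1), derivative_sub, derivative_mul, derivative_X, ih]
    have h : derivative ((n + 1 : ℤ[X]) * hermite n) =
        (n + 1 : ℤ[X]) * derivative (hermite n) := by
      rw [derivative_mul]; simp
    rw [h, hermite_succ n]
    push_cast
    ring

theorem hasDerivAt_hermiteFun (n : ℕ) (x : ℝ) :
    HasDerivAt (hermiteFun n) (aeval x (derivative (hermite n))) x :=
  Polynomial.hasDerivAt_aeval _ x

theorem aeval_derivative_hermite (n : ℕ) (x : ℝ) :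
    aeval x (derivative (hermite n)) = x * hermiteFun n x - hermiteFun (n + 1) x := by
  rw [hermiteFun, hermiteFun, hermite_succ n]
  simp only [map_sub, map_mul, aeval_X]
  ring

/-- Together with `aeval_derivative_hermite` this is the three-term recurrence `x H_{n+1} = H_{n+2}
+ (n+1) H_n`. -/
theorem aeval_derivative_hermite_succ (n : ℕ) (x : ℝ) :
    aeval x (derivative (hermite (n + 1))) = (n + 1) * hermiteFun n x := by
  rw [derivative_hermite_succ]
  simp

theorem hermiteFun_zero (x : ℝ) : hermiteFun 0 x = 1 := by simp [hermiteFun]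

theorem continuous_hermiteFun (n : ℕ) : Continuous (hermiteFun n) :=
  Polynomial.continuous_aeval _

theorem hasDerivAt_stdGaussian (x : ℝ) :
    HasDerivAt stdGaussian (-x * stdGaussian x) x := by
  have h : HasDerivAt (fun y : ℝ => -(y - 0) ^ 2 / (2 * ((1 : NNReal) : ℝ))) (-x) x := by
    have := (((hasDerivAt_id x).sub_const 0).pow 2).neg.div_const (2 * ((1 : NNReal) : ℝ))
    convert! this using 1
    simp; ring
  have := h.exp.const_mul (√(2 * Real.pi * ((1 : NNReal) : ℝ)))⁻¹
  convert! this using 1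
  simp only [gaussianPDFReal]
  ring

theorem hasDerivAt_hermiteFun_mul_stdGaussian (n : ℕ) (x : ℝ) :
    HasDerivAt (fun y => hermiteFun n y * stdGaussian y)
      (-(hermiteFun (n + 1) x * stdGaussian x)) x := by
  convert! (hasDerivAt_hermiteFun n x).mul (hasDerivAt_stdGaussian x) using 1
  rw [aeval_derivative_hermite]
  ring

theorem integrable_aeval_gaussianReal (P : ℤ[X]) :
    Integrable (fun x : ℝ => aeval x P) (gaussianReal 0 1) := by
  induction P using Polynomial.induction_on' with
  | add p q hp hq =>
    simp only [map_add]
    exact hp.add hq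
  | monomial n a =>
    have h : Integrable (fun x : ℝ => x ^ n) (gaussianReal 0 1) := by
      have := (memLp_id_gaussianReal (μ := 0) (v := 1) n).integrable_norm_pow'
      refine this.mono' (by fun_prop) (Eventually.of_forall fun x => by simp)
    simpa using h.const_mul (a : ℝ)

theorem integral_gaussianReal_eq (f : ℝ → ℝ) :
    ∫ x, f x ∂(gaussianReal 0 1) = ∫ x, f x * stdGaussian x := by
  rw [integral_gaussianReal_eq_integral_smul one_ne_zero]
  simp [mul_comm]

theorem integrable_gaussianReal_iff (f : ℝ → ℝ) :
    Integrable f (gaussianReal 0 1) ↔ Integrable (fun x => f x * stdGaussian x) := by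
  rw [gaussianReal_of_var_ne_zero _ one_ne_zero,
    integrable_withDensity_iff (measurable_gaussianPDF 0 1)
      (Eventually.of_forall fun _ => gaussianPDF_lt_top)]
  simp [toReal_gaussianPDF]

theorem integrable_bounded_mul_hermiteFun {φ : ℝ → ℝ} {C : ℝ} (hφ : Measurable φ)
    (hC : ∀ x, |φ x| ≤ C) (n : ℕ) :
    Integrable (fun x => φ x * hermiteFun n x) (gaussianReal 0 1) :=
  (integrable_aeval_gaussianReal (hermite n)).bdd_mul hφ.aestronglyMeasurable
    (Eventually.of_forall hC)

/-- Integration by parts against `(H_n ρ)' = -H_{n+1} ρ`; boundedness of `φ` and `φ'` supplies all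
integrability. -/
theorem integral_deriv_mul_hermiteFun {φ : ℝ → ℝ} {C C' : ℝ} (hφ : Differentiable ℝ φ)
    (hC : ∀ x, |φ x| ≤ C) (hC' : ∀ x, |deriv φ x| ≤ C') (n : ℕ) :
    ∫ x, deriv φ x * hermiteFun n x ∂(gaussianReal 0 1) =
      ∫ x, φ x * hermiteFun (n + 1) x ∂(gaussianReal 0 1) := by
  have i1 (k) := (integrable_gaussianReal_iff _).1
    (integrable_bounded_mul_hermiteFun hφ.continuous.measurable hC k)
  have i2 := (integrable_gaussianReal_iff _).1
    (integrable_bounded_mul_hermiteFun (measurable_deriv φ) hC' n)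
  have h := integral_mul_deriv_eq_deriv_mul_of_integrable (u := φ) (u' := deriv φ)
    (v := fun x => hermiteFun n x * stdGaussian x)
    (v' := fun x => -(hermiteFun (n + 1) x * stdGaussian x))
    (fun x _ => (hφ x).hasDerivAt) (fun x _ => hasDerivAt_hermiteFun_mul_stdGaussian n x)
    (by refine (i1 (n + 1)).neg.congr (Eventually.of_forall fun x => ?_); simp; ring)
    (by refine i2.congr (Eventually.of_forall fun x => ?_); simp; ring)
    (by refine (i1 n).congr (Eventually.of_forall fun x => ?_); simp; ring)
  simp only [mul_neg, integral_neg, neg_inj] at h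
  rw [integral_gaussianReal_eq, integral_gaussianReal_eq]
  simp only [mul_assoc]
  exact h.symm

theorem hermiteCoeff_eq (φ : ℝ → ℝ) (n : ℕ) :
    hermiteCoeff φ n =
      (∫ x, φ x * hermiteFun n x ∂(gaussianReal 0 1)) / √(n.factorial : ℝ) := by
  simp only [hermiteCoeff, hermiteNormalized, ← mul_div_assoc, integral_div]

theorem sqrt_factorial_succ (n : ℕ) :
    √((n + 1).factorial : ℝ) = √(n + 1 : ℝ) * √(n.factorial : ℝ) := by
  rw [Nat.factorial_succ, ← Real.sqrt_mul (by positivity)]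
  push_cast
  rfl

theorem hermiteCoeff_deriv {φ : ℝ → ℝ} {C C' : ℝ} (hφ : Differentiable ℝ φ)
    (hC : ∀ x, |φ x| ≤ C) (hC' : ∀ x, |deriv φ x| ≤ C') (n : ℕ) :
    hermiteCoeff (deriv φ) n = √(n + 1 : ℝ) * hermiteCoeff φ (n + 1) := by
  rw [hermiteCoeff_eq, hermiteCoeff_eq, integral_deriv_mul_hermiteFun hφ hC hC',
    sqrt_factorial_succ]
  have h1 : √(n + 1 : ℝ) ≠ 0 := by positivity
  have h2 : √(n.factorial : ℝ) ≠ 0 := by positivity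
  field_simp

theorem hermiteFun_at_zero (n : ℕ) : hermiteFun n 0 = ((hermite n).coeff 0 : ℝ) := by
  rw [hermiteFun, ← coeff_zero_eq_aeval_zero']; rfl

theorem hermiteFun_odd_at_zero {n : ℕ} (hn : Odd n) : hermiteFun n 0 = 0 := by
  rw [hermiteFun_at_zero, coeff_hermite_of_odd_add (by simpa using hn)]
  simp

theorem hermiteFun_even_at_zero_sq (m : ℕ) :
    hermiteFun (2 * m) 0 ^ 2 = ((2 * m - 1).doubleFactorial : ℝ) ^ 2 := by
  have := coeff_hermite_explicit m 0
  rw [hermiteFun_at_zero]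
  simp only [add_zero] at this
  rw [this]
  push_cast
  rw [mul_pow, mul_pow, ← pow_mul, mul_comm m 2, pow_mul]
  simp

/-! ### Reduction of the kernel coefficients to `n μ_n²`. -/

/-- The derivative relation is assumed only at the two indices used, so that ReLU, which is not
differentiable at `0`, is covered. -/
theorem kappaTwo_succ {φ : ℝ → ℝ} (σw σb γw γb : ℝ) {p : ℕ} (hp : 1 ≤ p)
    (h0 : hermiteCoeff (deriv φ) (p - 1) = √(p : ℝ) * hermiteCoeff φ p)
    (h1 : hermiteCoeff (deriv φ) p = √(p + 1 : ℝ) * hermiteCoeff φ (p + 1)) :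
    kappaTwo φ σw σb γw γb p = σw ^ 2 * (hermiteCoeff φ p ^ 2 +
      γw ^ 2 * (p * hermiteCoeff φ p ^ 2) +
      γb ^ 2 * (((p + 1 : ℕ) : ℝ) * hermiteCoeff φ (p + 1) ^ 2)) := by
  obtain ⟨m, rfl⟩ : ∃ m, p = m + 1 := ⟨p - 1, by omega⟩
  have e0 : hermiteCoeff (deriv φ) m ^ 2 = (m + 1 : ℝ) * hermiteCoeff φ (m + 1) ^ 2 := by
    rw [Nat.add_sub_cancel] at h0
    rw [h0, mul_pow, Real.sq_sqrt (by positivity)]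
    push_cast; ring
  have e1 : hermiteCoeff (deriv φ) (m + 1) ^ 2 =
      (m + 1 + 1 : ℝ) * hermiteCoeff φ (m + 1 + 1) ^ 2 := by
    rw [h1, mul_pow, Real.sq_sqrt (by positivity)]
    push_cast; ring
  -- Peel off `q = 0` and `q = 1`; `kappaOne` vanishes at every later index.
  rw [kappaTwo, Finset.sum_range_succ', Finset.sum_range_succ', Finset.sum_eq_zero]
  · simp only [kappaOne, alphaTwo, upsilonTwo]
    simp only [zero_add, Nat.add_sub_cancel, Nat.sub_zero, e0, e1]
    simp
    ring
  · intro i _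
    simp [kappaOne]

/-- For even `p` the term `γw² p μ_p²` already has order `g p`, and `μ_{p+1} = 0`. For odd `p` only
`γb² (p+1) μ_{p+1}²` survives; it has order `g (p+1)`, which `d` and `D` compare with `g p`. -/
theorem kappaTwo_isTheta {φ : ℝ → ℝ} {g : ℕ → ℝ} {σw γw γb : ℝ} (σb : ℝ)
    (hσw : 0 < σw) (hγw : 0 < γw) (hγb : 0 ≤ γb)
    (hder : ∀ᶠ n : ℕ in atTop,
      hermiteCoeff (deriv φ) n = √(n + 1 : ℝ) * hermiteCoeff φ (n + 1))
    (hodd : ∀ᶠ n : ℕ in atTop, Odd n → hermiteCoeff φ n = 0)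
    (hg : ∀ᶠ n : ℕ in atTop, 0 ≤ g n) {c C d D : ℝ} (hc : 0 < c) (hC : 0 ≤ C) (hd : 0 < d)
    (hlower : ∀ᶠ n : ℕ in atTop, Even n → c * g n ≤ n * hermiteCoeff φ n ^ 2)
    (hupper : ∀ᶠ n : ℕ in atTop, Even n → n * hermiteCoeff φ n ^ 2 ≤ C * g n)
    (hgl : ∀ᶠ n : ℕ in atTop, d * g n ≤ g (n + 1))
    (hgu : ∀ᶠ n : ℕ in atTop, g (n + 1) ≤ D * g n) :
    kappaTwo φ σw σb γw γb =Θ[atTop] indicator {p : ℕ | Even p ∨ 0 < γb} g := by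
  have hder' : ∀ᶠ n : ℕ in atTop,
      hermiteCoeff (deriv φ) (n - 1) = √(n : ℝ) * hermiteCoeff φ n := by
    filter_upwards [(tendsto_sub_atTop_nat 1).eventually hder, eventually_ge_atTop 1] with n hn h1
    rwa [Nat.sub_add_cancel h1, Nat.cast_sub h1, Nat.cast_one, sub_add_cancel] at hn
  have shift {P : ℕ → Prop} (h : ∀ᶠ n in atTop, P n) : ∀ᶠ n in atTop, P (n + 1) :=
    (tendsto_add_atTop_nat 1).eventually h
  have hA : 0 < σw ^ 2 := by positivity
  have hB : 0 < γw ^ 2 := by positivity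
  have hE : 0 ≤ γb ^ 2 := by positivity
  constructor
  · refine IsBigO.of_bound (σw ^ 2 * (1 + γw ^ 2) * C + σw ^ 2 * γb ^ 2 * C * |D|) ?_
    filter_upwards [hder, hder', hodd, shift hodd, hg, shift hg, hupper, shift hupper, hgu,
      eventually_ge_atTop 1] with n h1 h2 h3 h3' h4 h4' h5 h5' h6 hn
    rw [kappaTwo_succ σw σb γw γb hn h2 h1]
    have hs : hermiteCoeff φ n ^ 2 ≤ n * hermiteCoeff φ n ^ 2 :=
      le_mul_of_one_le_left (sq_nonneg _) (by exact_mod_cast hn)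
    have hnn : 0 ≤ C * |D| * g n := by positivity
    rw [Real.norm_of_nonneg (by positivity)]
    rcases Nat.even_or_odd n with he | ho
    · rw [h3' he.add_one, indicator_of_mem (by exact Or.inl he), Real.norm_of_nonneg h4]
      have h5 := h5 he
      have : hermiteCoeff φ n ^ 2 + γw ^ 2 * (n * hermiteCoeff φ n ^ 2) ≤
          (1 + γw ^ 2) * (C * g n) := by nlinarith
      calc _ = σw ^ 2 * (hermiteCoeff φ n ^ 2 + γw ^ 2 * (n * hermiteCoeff φ n ^ 2)) := by ring
        _ ≤ σw ^ 2 * ((1 + γw ^ 2) * (C * g n)) := by gcongr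
        _ ≤ σw ^ 2 * ((1 + γw ^ 2) * (C * g n)) + σw ^ 2 * γb ^ 2 * (C * |D| * g n) :=
          le_add_of_nonneg_right (by positivity)
        _ = _ := by ring
    · rw [h3 ho]
      rcases hγb.eq_or_lt with rfl | hb
      · simp only [ne_eq, OfNat.ofNat_ne_zero, not_false_eq_true, zero_pow, mul_zero, zero_mul,
          add_zero]
        positivity
      · rw [indicator_of_mem (by exact Or.inr hb), Real.norm_of_nonneg h4]
        have h5 := h5' ho.add_one
        calc _ = σw ^ 2 * (γb ^ 2 * (((n + 1 : ℕ) : ℝ) * hermiteCoeff φ (n + 1) ^ 2)) := by ring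
          _ ≤ σw ^ 2 * (γb ^ 2 * (C * (|D| * g n))) := by
            gcongr σw ^ 2 * (γb ^ 2 * ?_)
            refine h5.trans ?_
            gcongr
            exact h6.trans (by gcongr; exact le_abs_self D)
          _ ≤ σw ^ 2 * (γb ^ 2 * (C * (|D| * g n))) + σw ^ 2 * (1 + γw ^ 2) * (C * g n) :=
            le_add_of_nonneg_right (by positivity)
          _ = _ := by ring
  · refine IsBigO.of_bound ((σw ^ 2 * γw ^ 2 * c)⁻¹ + (σw ^ 2 * γb ^ 2 * c * d)⁻¹) ?_
    filter_upwards [hder, hder', hg, hlower, shift hlower, hgl,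
      eventually_ge_atTop 1] with n h1 h2 h4 h5 h5' h6 hn
    rw [kappaTwo_succ σw σb γw γb hn h2 h1]
    rw [Real.norm_of_nonneg (r := σw ^ 2 * _) (by positivity)]
    by_cases hmem : n ∈ {p : ℕ | Even p ∨ 0 < γb}
    swap
    · rw [indicator_of_notMem hmem, norm_zero]; positivity
    rw [indicator_of_mem hmem, Real.norm_of_nonneg h4]
    rcases Nat.even_or_odd n with he | ho
    · have h5 := h5 he
      calc g n = (σw ^ 2 * γw ^ 2 * c)⁻¹ * (σw ^ 2 * (γw ^ 2 * (c * g n))) := by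
            field_simp
        _ ≤ _ := by
            gcongr ?_ * (_ * ?_)
            · exact le_add_of_nonneg_right (by positivity)
            · have : γw ^ 2 * (c * g n) ≤ γw ^ 2 * (n * hermiteCoeff φ n ^ 2) := by gcongr
              have : 0 ≤ γb ^ 2 * (((n + 1 : ℕ) : ℝ) * hermiteCoeff φ (n + 1) ^ 2) := by
                positivity
              linarith [sq_nonneg (hermiteCoeff φ n)]
    · have hb : 0 < γb := hmem.resolve_left (Nat.not_even_iff_odd.2 ho)
      have h5 := h5' ho.add_one
      calc g n = (σw ^ 2 * γb ^ 2 * c * d)⁻¹ * (σw ^ 2 * (γb ^ 2 * (c * (d * g n)))) := by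
            field_simp
        _ ≤ _ := by
            gcongr ?_ * (_ * ?_)
            · exact le_add_of_nonneg_left (by positivity)
            · have : γb ^ 2 * (c * (d * g n)) ≤
                  γb ^ 2 * (((n + 1 : ℕ) : ℝ) * hermiteCoeff φ (n + 1) ^ 2) := by
                exact mul_le_mul_of_nonneg_left
                  ((mul_le_mul_of_nonneg_left h6 hc.le).trans h5) hE
              have : 0 ≤ γw ^ 2 * (n * hermiteCoeff φ n ^ 2) := by positivity
              linarith [sq_nonneg (hermiteCoeff φ n)]

/-! ### Two-sided bounds for the central binomial ratio. -/

/-- The ratio `((2m-1)‼)² / (2m)!`, which equals `4^{-m} (2m choose m)`. -/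
noncomputable def centralRatio (m : ℕ) : ℝ :=
  ((2 * m - 1).doubleFactorial : ℝ) ^ 2 / ((2 * m).factorial : ℝ)

theorem doubleFactorial_two_mul_succ_sub_one (m : ℕ) :
    (2 * (m + 1) - 1).doubleFactorial = (2 * m + 1) * (2 * m - 1).doubleFactorial := by
  rw [show 2 * (m + 1) - 1 = 2 * m + 1 by omega, Nat.doubleFactorial_add_one]

theorem centralRatio_succ (m : ℕ) :
    centralRatio (m + 1) = centralRatio m * ((2 * m + 1) / (2 * m + 2)) := by
  rw [centralRatio, centralRatio, doubleFactorial_two_mul_succ_sub_one,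
    show 2 * (m + 1) = 2 * m + 1 + 1 by ring, Nat.factorial_succ, Nat.factorial_succ]
  push_cast
  have : ((2 * m).factorial : ℝ) ≠ 0 := by positivity
  field_simp
  ring

theorem centralRatio_pos (m : ℕ) : 0 < centralRatio m := by
  rw [centralRatio]; positivity

/-- By the ratio formula, `r_m² (2m+1)` is nonincreasing in `m`, while `r_m² · 4m` in the companion
lower bound is nondecreasing; so no Stirling estimate is needed. -/
theorem centralRatio_sq_le (m : ℕ) : centralRatio m ^ 2 * (2 * m + 1) ≤ 1 := by
  induction m with
  | zero => simp [centralRatio]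
  | succ m ih =>
    rw [centralRatio_succ]
    refine le_trans ?_ ih
    rw [mul_pow, mul_assoc]
    gcongr
    rw [div_pow, div_mul_eq_mul_div, div_le_iff₀ (by positivity)]
    push_cast
    nlinarith [(Nat.cast_nonneg m : (0 : ℝ) ≤ m)]

theorem le_centralRatio_sq (m : ℕ) (hm : 1 ≤ m) : 1 ≤ centralRatio m ^ 2 * (4 * m) := by
  induction m, hm using Nat.le_induction with
  | base => norm_num [centralRatio, Nat.factorial]
  | succ m hm ih =>
    rw [centralRatio_succ]
    refine ih.trans ?_
    rw [mul_pow, mul_assoc]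
    refine mul_le_mul_of_nonneg_left ?_ (sq_nonneg _)
    rw [div_pow, div_mul_eq_mul_div, le_div_iff₀ (by positivity)]
    push_cast
    nlinarith [(Nat.cast_nonneg m : (0 : ℝ) ≤ m)]

theorem centralRatio_le_rpow (m : ℕ) (hm : 1 ≤ m) :
    centralRatio m ≤ ((2 * m : ℕ) : ℝ) ^ (-(1 / 2) : ℝ) := by
  have h0 : (0 : ℝ) < ((2 * m : ℕ) : ℝ) := by positivity
  rw [Real.rpow_neg h0.le, ← Real.sqrt_eq_rpow, ← Real.sqrt_inv]
  refine Real.le_sqrt_of_sq_le ?_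
  rw [← one_div, le_div_iff₀ h0]
  refine le_trans ?_ (centralRatio_sq_le m)
  gcongr
  push_cast; linarith

theorem rpow_le_centralRatio (m : ℕ) (hm : 1 ≤ m) :
    (1 / 2) * ((2 * m : ℕ) : ℝ) ^ (-(1 / 2) : ℝ) ≤ centralRatio m := by
  have h0 : (0 : ℝ) < ((2 * m : ℕ) : ℝ) := by positivity
  refine le_of_sq_le_sq ?_ (centralRatio_pos m).le
  rw [Real.rpow_neg h0.le, ← Real.sqrt_eq_rpow, mul_pow, inv_pow, Real.sq_sqrt h0.le]
  have := le_centralRatio_sq m hm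
  rw [← div_eq_mul_inv, div_le_iff₀ h0]
  push_cast
  nlinarith

/-! ### The ReLU activation. -/

theorem integrable_aeval_mul_stdGaussian (P : ℤ[X]) :
    Integrable (fun x : ℝ => aeval x P * stdGaussian x) :=
  (integrable_gaussianReal_iff _).1 (integrable_aeval_gaussianReal P)

theorem integral_Ioi_hermiteFun_succ (n : ℕ) :
    ∫ x in Ioi 0, hermiteFun (n + 1) x * stdGaussian x = hermiteFun n 0 * stdGaussian 0 := by
  have hd (x : ℝ) : HasDerivAt (fun y => -(hermiteFun n y * stdGaussian y))
      (hermiteFun (n + 1) x * stdGaussian x) x := by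
    convert! (hasDerivAt_hermiteFun_mul_stdGaussian n x).neg using 1
    rw [neg_neg]
  have h1 := (integrable_aeval_mul_stdGaussian (hermite (n + 1))).integrableOn (s := Ioi 0)
  have h2 := (integrable_aeval_mul_stdGaussian (hermite n)).neg.integrableOn (s := Ioi 0)
  rw [integral_Ioi_of_hasDerivAt_of_tendsto' (fun x _ => hd x) h1
    (tendsto_zero_of_hasDerivAt_of_integrableOn_Ioi (fun x _ => hd x) h1 h2)]
  simp

/-- An antiderivative is `-(x H_{n+1} + H_n) ρ`. It tends to zero at infinity because both it and
its derivative are integrable, leaving the boundary value at `0`. -/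
theorem integral_Ioi_mul_hermiteFun_add_two (n : ℕ) :
    ∫ x in Ioi 0, x * hermiteFun (n + 2) x * stdGaussian x =
      hermiteFun n 0 * stdGaussian 0 := by
  have hd (x : ℝ) : HasDerivAt
      (fun y => -(y * hermiteFun (n + 1) y * stdGaussian y + hermiteFun n y * stdGaussian y))
      (x * hermiteFun (n + 2) x * stdGaussian x) x := by
    have := (((hasDerivAt_id x).mul (hasDerivAt_hermiteFun_mul_stdGaussian (n + 1) x)).add
      (hasDerivAt_hermiteFun_mul_stdGaussian n x)).neg
    convert! this using 1
    · ext y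
      simp [mul_assoc]
    · simp only [id]; ring
  have hX (k : ℕ) : Integrable (fun x : ℝ => x * hermiteFun k x * stdGaussian x) := by
    refine (integrable_aeval_mul_stdGaussian (X * hermite k)).congr
      (Eventually.of_forall fun x => ?_)
    simp only [map_mul, aeval_X]
  have h1 := (hX (n + 2)).integrableOn (s := Ioi 0)
  have h2 := ((hX (n + 1)).add (integrable_aeval_mul_stdGaussian (hermite n))).neg.integrableOn
    (s := Ioi 0)
  rw [integral_Ioi_of_hasDerivAt_of_tendsto' (fun x _ => hd x) h1
    (tendsto_zero_of_hasDerivAt_of_integrableOn_Ioi (fun x _ => hd x) h1 h2)]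
  simp

theorem hermiteCoeff_relu (n : ℕ) :
    hermiteCoeff relu (n + 2) =
      hermiteFun n 0 * stdGaussian 0 / √((n + 2).factorial : ℝ) := by
  rw [hermiteCoeff_eq, integral_gaussianReal_eq, ← integral_Ioi_mul_hermiteFun_add_two,
    ← integral_indicator measurableSet_Ioi]
  congr 2
  ext x
  rcases le_or_gt x 0 with hx | hx
  · rw [indicator_of_notMem (by simpa using hx), relu, max_eq_left hx]
    ring
  · rw [indicator_of_mem (by simpa using hx), relu, max_eq_right hx.le]

theorem deriv_relu_of_neg {x : ℝ} (hx : x < 0) : deriv relu x = 0 := by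
  have : relu =ᶠ[nhds x] fun _ => 0 := by
    filter_upwards [Iio_mem_nhds hx] with y hy
    exact max_eq_left (le_of_lt hy)
  rw [this.deriv_eq, deriv_const]

theorem deriv_relu_of_pos {x : ℝ} (hx : 0 < x) : deriv relu x = 1 := by
  have : relu =ᶠ[nhds x] id := by
    filter_upwards [Ioi_mem_nhds hx] with y hy
    exact max_eq_right (le_of_lt hy)
  rw [this.deriv_eq, deriv_id]

theorem hermiteCoeff_deriv_relu (n : ℕ) :
    hermiteCoeff (deriv relu) (n + 1) =
      hermiteFun n 0 * stdGaussian 0 / √((n + 1).factorial : ℝ) := by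
  rw [hermiteCoeff_eq, integral_gaussianReal_eq, ← integral_Ioi_hermiteFun_succ,
    ← integral_indicator measurableSet_Ioi]
  congr 1
  refine integral_congr_ae ?_
  filter_upwards [compl_mem_ae_iff.2 (measure_singleton (0 : ℝ))] with x hx
  rcases lt_or_gt_of_ne (show x ≠ 0 from hx) with hx | hx
  · rw [indicator_of_notMem (by simpa using hx.le), deriv_relu_of_neg hx]
    ring
  · rw [indicator_of_mem (by simpa using hx), deriv_relu_of_pos hx, one_mul]

/-- Read off from the two closed forms, since ReLU is neither bounded nor differentiable at `0` and
the general integration by parts does not apply. -/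
theorem hermiteCoeff_deriv_relu_eq (n : ℕ) :
    hermiteCoeff (deriv relu) (n + 1) =
      √((n + 1 : ℕ) + 1 : ℝ) * hermiteCoeff relu (n + 1 + 1) := by
  rw [hermiteCoeff_deriv_relu, hermiteCoeff_relu, sqrt_factorial_succ (n + 1)]
  have h1 : √((n + 1 : ℕ) + 1 : ℝ) ≠ 0 := by positivity
  have h2 : √((n + 1).factorial : ℝ) ≠ 0 := by positivity
  field_simp

theorem stdGaussian_zero_sq : stdGaussian 0 ^ 2 = (2 * Real.pi)⁻¹ := by
  rw [stdGaussian, gaussianPDFReal]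
  simp only [NNReal.coe_one, mul_one, sub_zero, ne_eq, OfNat.ofNat_ne_zero, not_false_eq_true,
    zero_pow, neg_zero, zero_div, Real.exp_zero, inv_pow]
  rw [Real.sq_sqrt (by positivity)]

theorem hermiteCoeff_relu_even_sq (m : ℕ) :
    hermiteCoeff relu (2 * (m + 1)) ^ 2 =
      centralRatio (m + 1) / ((2 * m + 1) ^ 2 * (2 * Real.pi)) := by
  rw [show 2 * (m + 1) = 2 * m + 2 by ring, hermiteCoeff_relu, div_pow, mul_pow,
    stdGaussian_zero_sq, hermiteFun_even_at_zero_sq, Real.sq_sqrt (by positivity), centralRatio,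
    doubleFactorial_two_mul_succ_sub_one, show 2 * (m + 1) = 2 * m + 2 by ring]
  have h2 : ((2 * m + 2).factorial : ℝ) ≠ 0 := by positivity
  push_cast
  field_simp

theorem hermiteCoeff_relu_odd {n : ℕ} (hn : Odd n) (h : 2 ≤ n) : hermiteCoeff relu n = 0 := by
  obtain ⟨k, rfl⟩ : ∃ k, n = k + 2 := ⟨n - 2, by omega⟩
  have : Odd k := by
    rcases Nat.even_or_odd k with hk | hk
    · exact absurd hn (Nat.not_odd_iff_even.2 (hk.add (by decide)))
    · exact hk
  rw [hermiteCoeff_relu, hermiteFun_odd_at_zero this]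
  simp

theorem rpow_succ_lower {a : ℝ} (ha : 0 ≤ a) (n : ℕ) (hn : 1 ≤ n) :
    (2 : ℝ) ^ (-a) * (n : ℝ) ^ (-a) ≤ ((n + 1 : ℕ) : ℝ) ^ (-a) := by
  rw [← Real.mul_rpow (by norm_num) (by positivity)]
  refine Real.rpow_le_rpow_of_nonpos (by positivity) ?_ (by linarith)
  have : (1 : ℝ) ≤ n := by exact_mod_cast hn
  push_cast; linarith

theorem rpow_succ_upper {a : ℝ} (ha : 0 ≤ a) (n : ℕ) (hn : 1 ≤ n) :
    ((n + 1 : ℕ) : ℝ) ^ (-a) ≤ 1 * (n : ℝ) ^ (-a) := by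
  rw [one_mul]
  refine Real.rpow_le_rpow_of_nonpos (by positivity) ?_ (by linarith)
  push_cast; linarith

theorem rpow_neg_three_halves {n : ℕ} (hn : 1 ≤ n) :
    (n : ℝ) ^ (-(3 / 2) : ℝ) = (n : ℝ) ^ (-(1 / 2) : ℝ) / n := by
  have h0 : (0 : ℝ) < n := by positivity
  rw [show (-(3 / 2) : ℝ) = -(1 / 2) - 1 by norm_num, Real.rpow_sub_one h0.ne']

theorem kappaTwo_relu_isTheta {σw γw γb : ℝ} (σb : ℝ) (hσw : 0 < σw) (hγw : 0 < γw)
    (hγb : 0 ≤ γb) :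
    kappaTwo relu σw σb γw γb =Θ[atTop]
      indicator {p : ℕ | Even p ∨ 0 < γb} (fun p : ℕ => (p : ℝ) ^ (-(3 / 2) : ℝ)) := by
  -- With `n = 2(k+1)`, `n μ_n² = n r / (2π (n-1)²)`, where `r` is the central ratio. The constants
  -- come from `n^(-1/2)/2 ≤ r ≤ n^(-1/2)` and `(n-1)² ≤ n² ≤ 4(n-1)²`.
  refine kappaTwo_isTheta (c := (4 * Real.pi)⁻¹) (C := 2 / Real.pi) (d := 2 ^ (-(3 / 2) : ℝ))
    (D := 1) σb hσw hγw hγb ?_ ?_ ?_ (by positivity) (by positivity) (by positivity) ?_ ?_ ?_ ?_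
  · filter_upwards [eventually_ge_atTop 1] with n hn
    obtain ⟨k, rfl⟩ : ∃ k, n = k + 1 := ⟨n - 1, by omega⟩
    exact hermiteCoeff_deriv_relu_eq k
  · filter_upwards [eventually_ge_atTop 2] with n hn ho using hermiteCoeff_relu_odd ho hn
  · exact Eventually.of_forall fun n => by positivity
  · filter_upwards [eventually_ge_atTop 1] with n hn he
    obtain ⟨k, rfl⟩ : ∃ k, n = 2 * (k + 1) := by
      obtain ⟨r, rfl⟩ := he; exact ⟨r - 1, by omega⟩
    rw [hermiteCoeff_relu_even_sq, rpow_neg_three_halves hn]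
    refine le_trans (mul_le_mul_of_nonneg_left (div_le_div_of_nonneg_right
      (b := 2 * centralRatio (k + 1)) ?_ (by positivity)) (by positivity)) ?_
    · linarith [rpow_le_centralRatio (k + 1) (by omega)]
    · have hr := centralRatio_pos (k + 1)
      have hpi := Real.pi_pos
      have hk : (2 * (k : ℝ) + 1) ^ 2 ≤ (2 * (k + 1)) ^ 2 := by gcongr; linarith
      rw [← mul_div_assoc, ← mul_div_assoc, div_le_div_iff₀ (by positivity) (by positivity)]
      push_cast
      calc _ = centralRatio (k + 1) * (2 * (k : ℝ) + 1) ^ 2 := by field_simp; ring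
        _ ≤ centralRatio (k + 1) * (2 * (k + 1)) ^ 2 := by gcongr
        _ = _ := by ring
  · filter_upwards [eventually_ge_atTop 1] with n hn he
    obtain ⟨k, rfl⟩ : ∃ k, n = 2 * (k + 1) := by
      obtain ⟨r, rfl⟩ := he; exact ⟨r - 1, by omega⟩
    rw [hermiteCoeff_relu_even_sq, rpow_neg_three_halves hn]
    refine le_trans ?_ (mul_le_mul_of_nonneg_left (div_le_div_of_nonneg_right
      (centralRatio_le_rpow (k + 1) (by omega)) (by positivity)) (by positivity))
    have hr := centralRatio_pos (k + 1)
    have hpi := Real.pi_pos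
    have hk : (2 * ((k : ℝ) + 1)) ^ 2 ≤ 4 * (2 * k + 1) ^ 2 := by
      nlinarith [(Nat.cast_nonneg k : (0 : ℝ) ≤ k)]
    rw [← mul_div_assoc, ← mul_div_assoc, div_le_div_iff₀ (by positivity) (by positivity)]
    push_cast
    calc _ = centralRatio (k + 1) * (2 * ((k : ℝ) + 1)) ^ 2 := by ring
      _ ≤ centralRatio (k + 1) * (4 * (2 * k + 1) ^ 2) := by gcongr
      _ = _ := by field_simp; ring
  · filter_upwards [eventually_ge_atTop 1] with n hn using rpow_succ_lower (by norm_num) n hn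
  · filter_upwards [eventually_ge_atTop 1] with n hn using rpow_succ_upper (by norm_num) n hn

/-! ### The Gaussian activation. -/

theorem hasDerivAt_gaussianActivation (σ : ℝ) (x : ℝ) :
    HasDerivAt (gaussianActivation σ) (-(x / σ ^ 2) * gaussianActivation σ x) x := by
  have h : HasDerivAt (fun y : ℝ => -y ^ 2 / (2 * σ ^ 2)) (-(x / σ ^ 2)) x := by
    have := ((hasDerivAt_id x).pow 2).neg.div_const (2 * σ ^ 2)
    convert! this using 1
    simp
    rw [neg_div, mul_div_mul_left _ _ two_ne_zero]
  convert! h.exp.const_mul (1 / √(2 * Real.pi * σ ^ 2)) using 1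
  rw [gaussianActivation]
  ring

theorem deriv_gaussianActivation (σ : ℝ) (x : ℝ) :
    deriv (gaussianActivation σ) x = -(x / σ ^ 2) * gaussianActivation σ x :=
  (hasDerivAt_gaussianActivation σ x).deriv

theorem differentiable_gaussianActivation (σ : ℝ) : Differentiable ℝ (gaussianActivation σ) :=
  fun x => (hasDerivAt_gaussianActivation σ x).differentiableAt

theorem gaussianActivation_pos {σ : ℝ} (hσ : 0 < σ) (x : ℝ) : 0 < gaussianActivation σ x := by
  rw [gaussianActivation]; positivity

theorem abs_gaussianActivation_le {σ : ℝ} (hσ : 0 < σ) (x : ℝ) :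
    |gaussianActivation σ x| ≤ 1 / √(2 * Real.pi * σ ^ 2) := by
  rw [abs_of_pos (gaussianActivation_pos hσ x), gaussianActivation]
  refine mul_le_of_le_one_right (by positivity) (Real.exp_le_one_iff.2 ?_)
  rw [neg_div]
  exact neg_nonpos.2 (by positivity)

theorem abs_deriv_gaussianActivation_le {σ : ℝ} (hσ : 0 < σ) (x : ℝ) :
    |deriv (gaussianActivation σ) x| ≤ 1 / √(2 * Real.pi * σ ^ 2) / σ := by
  rw [deriv_gaussianActivation, abs_mul, abs_neg, abs_of_pos (gaussianActivation_pos hσ x),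
    gaussianActivation, abs_div, abs_of_pos (show 0 < σ ^ 2 by positivity)]
  -- With `u = |x|/σ` this is `u ≤ 1 + u²/2 ≤ e^{u²/2}`.
  have h : |x| / σ * Real.exp (-x ^ 2 / (2 * σ ^ 2)) ≤ 1 := by
    rw [neg_div, Real.exp_neg, ← div_eq_mul_inv, div_le_one (Real.exp_pos _)]
    have h1 := Real.add_one_le_exp (x ^ 2 / (2 * σ ^ 2))
    have h2 : x ^ 2 / (2 * σ ^ 2) = (|x| / σ) ^ 2 / 2 := by
      rw [div_pow, sq_abs]; field_simp
    rw [h2] at h1 ⊢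
    nlinarith [sq_nonneg (|x| / σ - 1)]
  calc _ = 1 / √(2 * Real.pi * σ ^ 2) / σ * (|x| / σ * Real.exp (-x ^ 2 / (2 * σ ^ 2))) := by
        field_simp
    _ ≤ _ := mul_le_of_le_one_right (by positivity) h

/-- The unnormalized Hermite coefficient of the Gaussian activation. -/
noncomputable def gaussianMoment (σ : ℝ) (n : ℕ) : ℝ :=
  ∫ x, gaussianActivation σ x * hermiteFun n x ∂(gaussianReal 0 1)

theorem integrable_gaussianActivation_mul_hermiteFun {σ : ℝ} (hσ : 0 < σ) (n : ℕ) :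
    Integrable (fun x => gaussianActivation σ x * hermiteFun n x) (gaussianReal 0 1) :=
  integrable_bounded_mul_hermiteFun (differentiable_gaussianActivation σ).continuous.measurable
    (abs_gaussianActivation_le hσ) n

theorem gaussianMoment_one {σ : ℝ} (hσ : 0 < σ) : gaussianMoment σ 1 = 0 := by
  have h : gaussianMoment σ 1 = -(1 / σ ^ 2) * gaussianMoment σ 1 := by
    conv_lhs => rw [gaussianMoment, ← integral_deriv_mul_hermiteFun
      (differentiable_gaussianActivation σ) (abs_gaussianActivation_le hσ)
      (abs_deriv_gaussianActivation_le hσ)]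
    rw [gaussianMoment, ← integral_const_mul]
    congr 1
    ext x
    rw [deriv_gaussianActivation]
    simp [hermiteFun]
    ring
  have : (0 : ℝ) < 1 / σ ^ 2 := by positivity
  nlinarith [sq_nonneg (gaussianMoment σ 1)]

/-- Integrate by parts, insert `φ' = -x φ / σ²`, and expand `x H_{n+1}` by the three-term
recurrence. The moment of order `n+2` then appears on both sides and can be solved for. -/
theorem gaussianMoment_add_two {σ : ℝ} (hσ : 0 < σ) (n : ℕ) :
    gaussianMoment σ (n + 2) = -((n + 1) / (σ ^ 2 + 1)) * gaussianMoment σ n := by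
  have h : gaussianMoment σ (n + 2) =
      -(1 / σ ^ 2) * (gaussianMoment σ (n + 2) + (n + 1) * gaussianMoment σ n) := by
    conv_lhs => rw [gaussianMoment, ← integral_deriv_mul_hermiteFun
      (differentiable_gaussianActivation σ) (abs_gaussianActivation_le hσ)
      (abs_deriv_gaussianActivation_le hσ)]
    rw [gaussianMoment, gaussianMoment, ← integral_const_mul ((n : ℝ) + 1), ← integral_add
      (integrable_gaussianActivation_mul_hermiteFun hσ (n + 2))
      ((integrable_gaussianActivation_mul_hermiteFun hσ n).const_mul _), ← integral_const_mul]
    congr 1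
    ext x
    have h1 := aeval_derivative_hermite (n + 1) x
    rw [aeval_derivative_hermite_succ] at h1
    rw [deriv_gaussianActivation]
    linear_combination (1 / σ ^ 2) * gaussianActivation σ x * h1
  field_simp at h ⊢
  linarith

theorem gaussianMoment_zero_pos {σ : ℝ} (hσ : 0 < σ) : 0 < gaussianMoment σ 0 := by
  have hi := integrable_gaussianActivation_mul_hermiteFun hσ 0
  simp only [hermiteFun_zero, mul_one] at hi
  rw [gaussianMoment]
  simp only [hermiteFun_zero, mul_one]
  rw [integral_pos_iff_support_of_nonneg (fun x => (gaussianActivation_pos hσ x).le) hi]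
  have : Function.support (gaussianActivation σ) = univ := by
    ext x; simp [(gaussianActivation_pos hσ x).ne']
  rw [this, measure_univ]
  exact one_pos

theorem gaussianMoment_odd {σ : ℝ} (hσ : 0 < σ) (m : ℕ) : gaussianMoment σ (2 * m + 1) = 0 := by
  induction m with
  | zero => exact gaussianMoment_one hσ
  | succ m ih =>
    rw [show 2 * (m + 1) + 1 = 2 * m + 1 + 2 by ring, gaussianMoment_add_two hσ, ih, mul_zero]

theorem gaussianMoment_even {σ : ℝ} (hσ : 0 < σ) (m : ℕ) :
    gaussianMoment σ (2 * m) =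
      (-(σ ^ 2 + 1)⁻¹) ^ m * (2 * m - 1).doubleFactorial * gaussianMoment σ 0 := by
  induction m with
  | zero => simp
  | succ m ih =>
    rw [doubleFactorial_two_mul_succ_sub_one, show 2 * (m + 1) = 2 * m + 2 by ring,
      gaussianMoment_add_two hσ, ih, pow_succ (-(σ ^ 2 + 1)⁻¹)]
    push_cast
    ring

theorem hermiteCoeff_gaussianActivation_odd {σ : ℝ} (hσ : 0 < σ) {n : ℕ} (hn : Odd n) :
    hermiteCoeff (gaussianActivation σ) n = 0 := by
  obtain ⟨m, rfl⟩ := hn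
  have := gaussianMoment_odd hσ m
  rw [gaussianMoment] at this
  rw [hermiteCoeff_eq, this, zero_div]

theorem hermiteCoeff_gaussianActivation_even_sq {σ : ℝ} (hσ : 0 < σ) (m : ℕ) :
    hermiteCoeff (gaussianActivation σ) (2 * m) ^ 2 =
      gaussianMoment σ 0 ^ 2 * centralRatio m * ((σ ^ 2 + 1) ^ (2 * m))⁻¹ := by
  have := gaussianMoment_even hσ m
  rw [gaussianMoment] at this
  rw [hermiteCoeff_eq, this, div_pow, Real.sq_sqrt (by positivity), centralRatio, mul_pow,
    mul_pow, ← pow_mul, mul_comm m 2, Even.neg_pow (even_two_mul m), inv_pow]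
  ring

theorem rpow_half_eq {n : ℕ} (hn : 1 ≤ n) :
    (n : ℝ) ^ (1 / 2 : ℝ) = n * (n : ℝ) ^ (-(1 / 2) : ℝ) := by
  have h0 : (0 : ℝ) < n := by positivity
  nth_rw 2 [← Real.rpow_one (n : ℝ)]
  rw [← Real.rpow_add h0]
  norm_num

theorem kappaTwo_gaussianActivation_isTheta {σw γw γb σ : ℝ} (σb : ℝ) (hσw : 0 < σw)
    (hγw : 0 < γw) (hγb : 0 ≤ γb) (hσ : 0 < σ) :
    kappaTwo (gaussianActivation σ) σw σb γw γb =Θ[atTop]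
      indicator {p : ℕ | Even p ∨ 0 < γb}
        (fun p : ℕ => (p : ℝ) ^ (1 / 2 : ℝ) * ((σ ^ 2 + 1) ^ p)⁻¹) := by
  have ha := gaussianMoment_zero_pos hσ
  refine kappaTwo_isTheta (c := gaussianMoment σ 0 ^ 2 / 2) (C := gaussianMoment σ 0 ^ 2)
    (d := (σ ^ 2 + 1)⁻¹) (D := 2 * (σ ^ 2 + 1)⁻¹)
    σb hσw hγw hγb ?_ ?_ ?_ (by positivity) (by positivity) (by positivity) ?_ ?_ ?_ ?_
  · exact Eventually.of_forall (hermiteCoeff_deriv (differentiable_gaussianActivation σ)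
      (abs_gaussianActivation_le hσ) (abs_deriv_gaussianActivation_le hσ))
  · exact Eventually.of_forall fun n ho => hermiteCoeff_gaussianActivation_odd hσ ho
  · exact Eventually.of_forall fun n => by positivity
  · filter_upwards [eventually_ge_atTop 1] with n hn he
    obtain ⟨m, rfl⟩ : ∃ m, n = 2 * m := he.exists_two_nsmul _
    rw [hermiteCoeff_gaussianActivation_even_sq hσ, rpow_half_eq hn]
    calc _ = ((2 * m : ℕ) : ℝ) * (gaussianMoment σ 0 ^ 2 *
          ((1 / 2) * ((2 * m : ℕ) : ℝ) ^ (-(1 / 2) : ℝ)) * ((σ ^ 2 + 1) ^ (2 * m))⁻¹) := by ring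
      _ ≤ _ := by gcongr; exact rpow_le_centralRatio m (by omega)
  · filter_upwards [eventually_ge_atTop 1] with n hn he
    obtain ⟨m, rfl⟩ : ∃ m, n = 2 * m := he.exists_two_nsmul _
    rw [hermiteCoeff_gaussianActivation_even_sq hσ, rpow_half_eq hn]
    calc _ ≤ ((2 * m : ℕ) : ℝ) * (gaussianMoment σ 0 ^ 2 *
          ((2 * m : ℕ) : ℝ) ^ (-(1 / 2) : ℝ) * ((σ ^ 2 + 1) ^ (2 * m))⁻¹) := by
            gcongr; exact centralRatio_le_rpow m (by omega)
      _ = _ := by ring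
  · refine Eventually.of_forall fun n => ?_
    calc _ = (n : ℝ) ^ (1 / 2 : ℝ) * ((σ ^ 2 + 1) ^ (n + 1))⁻¹ := by
          rw [pow_succ (σ ^ 2 + 1), mul_inv]; ring
      _ ≤ _ := by gcongr; omega
  · filter_upwards [eventually_ge_atTop 1] with n hn
    have h : ((n + 1 : ℕ) : ℝ) ^ (1 / 2 : ℝ) ≤ 2 * (n : ℝ) ^ (1 / 2 : ℝ) := by
      rw [← Real.sqrt_eq_rpow, ← Real.sqrt_eq_rpow, Real.sqrt_le_left (by positivity), mul_pow,
        Real.sq_sqrt (by positivity)]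
      have : (1 : ℝ) ≤ n := by exact_mod_cast hn
      push_cast; linarith
    calc _ ≤ 2 * (n : ℝ) ^ (1 / 2 : ℝ) * ((σ ^ 2 + 1) ^ (n + 1))⁻¹ := by gcongr
      _ = _ := by rw [pow_succ (σ ^ 2 + 1), mul_inv]; ring

/-! ### Partial fractions of tanh. -/

/-- The Mittag-Leffler series of the cotangent at `z = i x / π`, multiplied by `i / π`. -/
theorem hasSum_coth_sub_inv {x : ℝ} (hx : x ≠ 0) :
    HasSum (fun n : ℕ => 2 * x / (x ^ 2 + (Real.pi * (n + 1)) ^ 2))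
      (Real.cosh x / Real.sinh x - 1 / x) := by
  have hpi : (Real.pi : ℂ) ≠ 0 := by exact_mod_cast Real.pi_ne_zero
  have hx' : (x : ℂ) ≠ 0 := by exact_mod_cast hx
  set z : ℂ := x * Complex.I / Real.pi with hzdef
  have him : z.im = x / Real.pi := by
    rw [hzdef]
    simp [Complex.div_im]
    field_simp
  have hz : z ∈ Complex.integerComplement := by
    rintro ⟨n, hn⟩
    have h0 : z.im = 0 := by rw [← hn]; simp
    rw [him] at h0
    exact (div_ne_zero hx Real.pi_ne_zero) h0
  have h1 : HasSum (fun n : ℕ => 1 / (z - (n + 1)) + 1 / (z + (n + 1)))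
      (Real.pi * Complex.cot (Real.pi * z) - 1 / z) := by
    rw [cot_series_rep' hz]
    exact (summable_cotTerm hz).hasSum
  have h2 := h1.mul_left (Complex.I / Real.pi)
  rw [← Complex.hasSum_ofReal]
  have hsinh : (Real.sinh x : ℂ) ≠ 0 := by exact_mod_cast (Real.sinh_eq_zero.not.2 hx)
  convert! h2 using 1
  · ext n
    have hd : (x ^ 2 + (Real.pi * (n + 1)) ^ 2 : ℂ) ≠ 0 := by
      have : (0 : ℝ) < x ^ 2 + (Real.pi * (n + 1)) ^ 2 := by positivity
      exact_mod_cast this.ne'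
    have e1 : z + (n + 1) ≠ 0 := by
      intro h
      have := congrArg Complex.im h
      simp [him, hx, Real.pi_ne_zero] at this
    have e2 : z - (n + 1) ≠ 0 := by
      intro h
      have := congrArg Complex.im h
      simp [him, hx, Real.pi_ne_zero] at this
    have e3 : (z - (n + 1)) * (z + (n + 1)) = -(x ^ 2 + (Real.pi * (n + 1)) ^ 2) / Real.pi ^ 2 := by
      rw [hzdef]
      field_simp
      ring_nf
      simp only [Complex.I_sq]
      ring
    rw [one_div_add_one_div e2 e1, e3, hzdef]
    push_cast
    field_simp
    ring_nf
    simp only [Complex.I_sq]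
    ring
  · have e : (Real.pi : ℂ) * z = x * Complex.I := by rw [hzdef]; field_simp
    rw [e, Complex.cot, Complex.cos_mul_I, Complex.sin_mul_I, hzdef]
    push_cast at hsinh ⊢
    field_simp

/-- Uses `tanh x = 2 coth (2x) - coth x`: the odd-indexed terms of the series for `2 coth (2x)`
reproduce that of `coth x`, and the even-indexed ones remain. -/
theorem hasSum_tanh (x : ℝ) :
    HasSum (fun k : ℕ => 2 * x / (x ^ 2 + (Real.pi * (k + 1 / 2)) ^ 2)) (Real.tanh x) := by
  rcases eq_or_ne x 0 with rfl | hx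
  · simp
  have h1 := hasSum_coth_sub_inv hx
  have h2 := (hasSum_coth_sub_inv (mul_ne_zero two_ne_zero hx)).mul_left 2
  set f : ℕ → ℝ := fun n => 2 * (2 * (2 * x) / ((2 * x) ^ 2 + (Real.pi * (n + 1)) ^ 2)) with hf
  have hodd : HasSum (fun k : ℕ => f (2 * k + 1)) (Real.cosh x / Real.sinh x - 1 / x) := by
    convert! h1 using 2 with k
    simp only [hf]
    push_cast
    have : x ^ 2 + (Real.pi * (k + 1)) ^ 2 ≠ 0 := by positivity
    have : (2 * x) ^ 2 + (Real.pi * (2 * k + 1 + 1)) ^ 2 ≠ 0 := by positivity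
    field_simp
    ring
  have heven : HasSum (fun k : ℕ => f (2 * k)) (∑' k : ℕ, f (2 * k)) :=
    (h2.summable.comp_injective (mul_right_injective₀ two_ne_zero)).hasSum
  have hu := (heven.even_add_odd hodd).unique h2
  have hs := Real.sinh_ne_zero.2 hx
  have hc := (Real.cosh_pos x).ne'
  have hval : ∑' k : ℕ, f (2 * k) = Real.tanh x := by
    rw [eq_sub_of_add_eq hu, Real.tanh_eq_sinh_div_cosh, Real.sinh_two_mul, Real.cosh_two_mul]
    field_simp
    ring
  rw [← hval]
  convert! heven using 2 with k
  simp only [hf]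
  push_cast
  have : x ^ 2 + (Real.pi * (k + 1 / 2)) ^ 2 ≠ 0 := by positivity
  have : (2 * x) ^ 2 + (Real.pi * (2 * k + 1)) ^ 2 ≠ 0 := by positivity
  field_simp

theorem integral_exp_mul_sin {a : ℝ} (ha : 0 < a) (x : ℝ) :
    ∫ t in Ioi 0, 2 * Real.exp (-a * t) * Real.sin (t * x) = 2 * x / (x ^ 2 + a ^ 2) := by
  have hre : (-(a : ℂ) + x * Complex.I).re < 0 := by simpa using ha
  have h := integral_exp_mul_complex_Ioi hre 0
  have hi := integrableOn_exp_mul_complex_Ioi hre 0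
  have h2 := congrArg Complex.im h
  rw [← Complex.imCLM_apply, ← Complex.imCLM.integral_comp_comm hi] at h2
  have hd : x ^ 2 + a ^ 2 ≠ 0 := by positivity
  have e1 (t : ℝ) : 2 * Real.exp (-a * t) * Real.sin (t * x) =
      2 * Complex.imCLM (Complex.exp ((-(a : ℂ) + x * Complex.I) * t)) := by
    simp [Complex.exp_im]
    ring_nf
  simp only [e1]
  rw [integral_const_mul, h2]
  simp [Complex.div_im, Complex.normSq_apply]
  field_simp
  ring

/-! ### Hermite coefficients of tanh. -/

/-- Sine and cosine are treated jointly because each integration by parts swaps them and yields a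
factor `t`; the base case is the Gaussian characteristic function. -/
theorem abs_integral_sin_cos_mul_hermiteFun_le {t : ℝ} (ht : 0 ≤ t) (n : ℕ) :
    |∫ x, Real.sin (t * x) * hermiteFun n x ∂(gaussianReal 0 1)| ≤ t ^ n * Real.exp (-t ^ 2 / 2) ∧
    |∫ x, Real.cos (t * x) * hermiteFun n x ∂(gaussianReal 0 1)| ≤
      t ^ n * Real.exp (-t ^ 2 / 2) := by
  have ds : deriv (fun x => Real.sin (t * x)) = fun x => t * Real.cos (t * x) := by
    ext x
    have := ((hasDerivAt_id x).const_mul t).sin.deriv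
    simp only [id, mul_one] at this
    rw [this, mul_comm]
  have dc : deriv (fun x => Real.cos (t * x)) = fun x => -(t * Real.sin (t * x)) := by
    ext x
    have := ((hasDerivAt_id x).const_mul t).cos.deriv
    simp only [id, mul_one] at this
    rw [this]; ring
  induction n with
  | zero =>
    have h : charFun (gaussianReal 0 1) t = (Real.exp (-t ^ 2 / 2) : ℂ) := by
      rw [charFun_gaussianReal]; simp; ring_nf
    have hn : ‖charFun (gaussianReal 0 1) t‖ = Real.exp (-t ^ 2 / 2) := by
      rw [h, Complex.norm_real, Real.norm_of_nonneg (Real.exp_pos _).le]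
    rw [charFun_apply_real] at hn
    have hi : Integrable (fun x : ℝ => Complex.exp (t * x * Complex.I)) (gaussianReal 0 1) := by
      refine Integrable.of_bound (C := 1) (by fun_prop) (Eventually.of_forall fun x => ?_)
      rw [← Complex.ofReal_mul, Complex.norm_exp_ofReal_mul_I]
    simp only [hermiteFun_zero, mul_one, pow_zero, one_mul]
    rw [← hn]
    constructor
    · refine le_trans (le_of_eq ?_) (Complex.abs_im_le_norm _)
      rw [← Complex.imCLM_apply, ← Complex.imCLM.integral_comp_comm hi]
      congr 2; ext x
      rw [Complex.imCLM_apply, ← Complex.ofReal_mul, Complex.exp_ofReal_mul_I_im]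
    · refine le_trans (le_of_eq ?_) (Complex.abs_re_le_norm _)
      rw [← Complex.reCLM_apply, ← Complex.reCLM.integral_comp_comm hi]
      congr 2; ext x
      rw [Complex.reCLM_apply, ← Complex.ofReal_mul, Complex.exp_ofReal_mul_I_re]
  | succ n ih =>
    constructor
    · rw [← integral_deriv_mul_hermiteFun (C := 1) (C' := t) (by fun_prop)
        (fun x => Real.abs_sin_le_one _)
        (fun x => by
          rw [ds, abs_mul, abs_of_nonneg ht]
          exact mul_le_of_le_one_right ht (Real.abs_cos_le_one _)), ds]
      simp only [mul_assoc]
      rw [integral_const_mul, abs_mul, abs_of_nonneg ht, pow_succ', mul_assoc]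
      exact mul_le_mul_of_nonneg_left ih.2 ht
    · rw [← integral_deriv_mul_hermiteFun (C := 1) (C' := t) (by fun_prop)
        (fun x => Real.abs_cos_le_one _)
        (fun x => by
          rw [dc, abs_neg, abs_mul, abs_of_nonneg ht]
          exact mul_le_of_le_one_right ht (Real.abs_sin_le_one _)), dc]
      simp only [neg_mul, mul_assoc]
      rw [integral_neg, abs_neg, integral_const_mul, abs_mul, abs_of_nonneg ht, pow_succ',
        mul_assoc]
      exact mul_le_mul_of_nonneg_left ih.1 ht

/-- With `s = √m`, the inequality `t/s ≤ e^{t/s-1}` gives `t^m ≤ s^m e^{st-m}`, and `m^m ≤ m! e^m`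
gives `s^m ≤ √(m!) e^{m/2}`. The exponents combine to a perfect square. -/
theorem pow_mul_exp_neg_sq_le (m : ℕ) {t : ℝ} (ht : 0 ≤ t) :
    t ^ m * Real.exp (-t ^ 2 / 2) ≤
      √(m.factorial : ℝ) * Real.exp (-(t - √(m : ℝ)) ^ 2 / 2) := by
  rcases Nat.eq_zero_or_pos m with rfl | hm
  · simp
  have hs : 0 < √(m : ℝ) := by positivity
  have hs2 : √(m : ℝ) ^ 2 = m := Real.sq_sqrt (by positivity)
  have h1 : t ≤ √(m : ℝ) * Real.exp (t / √(m : ℝ) - 1) := by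
    have := Real.add_one_le_exp (t / √(m : ℝ) - 1)
    rw [sub_add_cancel, div_le_iff₀ hs] at this
    linarith
  have h2 : √(m : ℝ) ^ m ≤ √(m.factorial : ℝ) * Real.exp (m / 2) := by
    have h := Real.pow_div_factorial_le_exp (m : ℝ) (Nat.cast_nonneg m) m
    rw [div_le_iff₀ (by positivity)] at h
    refine le_of_sq_le_sq ?_ (by positivity)
    rw [← pow_mul, mul_comm m 2, pow_mul, hs2, mul_pow, Real.sq_sqrt (by positivity),
      ← Real.exp_nat_mul]
    convert! h using 1
    rw [mul_comm]
    congr 2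
    push_cast; ring
  calc t ^ m * Real.exp (-t ^ 2 / 2)
      ≤ (√(m : ℝ) * Real.exp (t / √(m : ℝ) - 1)) ^ m * Real.exp (-t ^ 2 / 2) := by gcongr
    _ = √(m : ℝ) ^ m * (Real.exp (m * (t / √(m : ℝ) - 1)) * Real.exp (-t ^ 2 / 2)) := by
        rw [mul_pow, ← Real.exp_nat_mul, mul_assoc]
    _ ≤ √(m.factorial : ℝ) * Real.exp (m / 2) *
        (Real.exp (m * (t / √(m : ℝ) - 1)) * Real.exp (-t ^ 2 / 2)) := by gcongr
    _ = _ := by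
        rw [mul_assoc, ← Real.exp_add, ← Real.exp_add]
        congr 2
        have : (m : ℝ) * (t / √(m : ℝ)) = √(m : ℝ) * t := by
          nth_rw 1 [← hs2]
          field_simp
        linear_combination this + hs2 / 2

theorem exp_neg_mul_gaussian_eq (b s t : ℝ) :
    Real.exp (-b * t) * Real.exp (-(t - s) ^ 2 / 2) =
      Real.exp (b ^ 2 / 2 - b * s) * Real.exp (-(1 / 2) * (t + (b - s)) ^ 2) := by
  rw [← Real.exp_add, ← Real.exp_add]
  congr 1
  ring

theorem integrable_exp_neg_mul_gaussian (b s : ℝ) :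
    Integrable (fun t => Real.exp (-b * t) * Real.exp (-(t - s) ^ 2 / 2)) := by
  simp only [exp_neg_mul_gaussian_eq]
  exact ((integrable_exp_neg_mul_sq (b := 1 / 2) (by norm_num)).comp_add_right _).const_mul _

theorem integral_Ioi_exp_neg_mul_gaussian_le (b s : ℝ) :
    ∫ t in Ioi 0, Real.exp (-b * t) * Real.exp (-(t - s) ^ 2 / 2) ≤
      √(2 * Real.pi) * Real.exp (b ^ 2 / 2) * Real.exp (-b * s) := by
  refine (setIntegral_le_integral (integrable_exp_neg_mul_gaussian b s)
    (Eventually.of_forall fun t => by positivity)).trans (le_of_eq ?_)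
  simp only [exp_neg_mul_gaussian_eq]
  rw [integral_const_mul, integral_add_right_eq_self
    (fun t : ℝ => Real.exp (-(1 / 2) * t ^ 2)), integral_gaussian, sub_eq_add_neg, Real.exp_add]
  rw [show Real.pi / (1 / 2) = 2 * Real.pi by ring, neg_mul]
  ring

theorem sq_mul_exp_neg_le (k : ℕ) {c t : ℝ} (ht : 0 ≤ t) (hc : ((k : ℝ) + 1) / 2 ≤ c) :
    t ^ 2 * Real.exp (-c * t) ≤ 8 / ((k : ℝ) + 1) ^ 2 := by
  have h1 : t ^ 2 * Real.exp (-c * t) ≤ t ^ 2 * Real.exp (-(((k : ℝ) + 1) / 2 * t)) := by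
    gcongr
    nlinarith
  refine h1.trans ?_
  have h2 := Real.quadratic_le_exp_of_nonneg (x := ((k : ℝ) + 1) / 2 * t) (by positivity)
  rw [Real.exp_neg, ← div_eq_mul_inv, div_le_div_iff₀ (Real.exp_pos _) (by positivity)]
  have : 0 ≤ ((k : ℝ) + 1) / 2 * t := by positivity
  nlinarith

theorem integral_pole_mul_hermiteFun {a : ℝ} (ha : 0 < a) (n : ℕ) :
    ∫ x, 2 * x / (x ^ 2 + a ^ 2) * hermiteFun n x ∂(gaussianReal 0 1) =
      ∫ t in Ioi 0, 2 * Real.exp (-a * t) *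
        ∫ x, Real.sin (t * x) * hermiteFun n x ∂(gaussianReal 0 1) := by
  have hint : Integrable (Function.uncurry fun x t : ℝ =>
      2 * Real.exp (-a * t) * Real.sin (t * x) * hermiteFun n x)
      ((gaussianReal 0 1).prod (volume.restrict (Ioi 0))) := by
    have h1 : Integrable (fun t : ℝ => 2 * Real.exp (-a * t)) (volume.restrict (Ioi 0)) :=
      (integrableOn_exp_mul_Ioi (neg_lt_zero.2 ha) 0).const_mul 2
    refine ((integrable_aeval_gaussianReal (hermite n)).mul_prod h1).mono ?_ ?_
    · have := continuous_hermiteFun n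
      refine Continuous.aestronglyMeasurable ?_
      simp only [Function.uncurry_def]
      fun_prop
    · refine Eventually.of_forall fun p => ?_
      simp only [Function.uncurry, norm_mul]
      have h := Real.abs_sin_le_one (p.2 * p.1)
      calc _ = ‖(2 : ℝ)‖ * ‖Real.exp (-a * p.2)‖ * ‖hermiteFun n p.1‖ *
            ‖Real.sin (p.2 * p.1)‖ := by ring
        _ ≤ ‖(2 : ℝ)‖ * ‖Real.exp (-a * p.2)‖ * ‖hermiteFun n p.1‖ * 1 := by
            gcongr; exact h
        _ = _ := by ring
  calc _ = ∫ x, (∫ t in Ioi 0,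
        2 * Real.exp (-a * t) * Real.sin (t * x) * hermiteFun n x) ∂(gaussianReal 0 1) := by
        congr 1; ext x
        rw [integral_mul_const, integral_exp_mul_sin ha]
    _ = _ := by
        rw [integral_integral_swap hint]
        congr 1; ext t
        rw [← integral_const_mul]
        congr 1; ext x
        ring

/-- The rate `π(k+1/2)` is split: `π/4` acts on the bump at `√n`, and the rest is spent on `t²` to
gain `1/(k+1)²`. Splitting `t^{n+2} = t² t^n` also leaves `√(n!)` instead of `√((n+2)!)`, which
later absorbs the factor `n+2` in `n μ_n²`. -/
theorem abs_integral_pole_mul_hermiteFun_le (n k : ℕ) :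
    |∫ x, 2 * x / (x ^ 2 + (Real.pi * (k + 1 / 2)) ^ 2) * hermiteFun (n + 2) x
        ∂(gaussianReal 0 1)| ≤
      16 / ((k : ℝ) + 1) ^ 2 * √(n.factorial : ℝ) *
        (√(2 * Real.pi) * Real.exp ((Real.pi / 4) ^ 2 / 2) *
          Real.exp (-(Real.pi / 4) * √(n : ℝ))) := by
  have hpi := Real.two_le_pi
  rw [integral_pole_mul_hermiteFun (by positivity)]
  refine le_trans ?_ (mul_le_mul_of_nonneg_left
    (integral_Ioi_exp_neg_mul_gaussian_le (Real.pi / 4) (√(n : ℝ))) (by positivity))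
  rw [← integral_const_mul, ← Real.norm_eq_abs]
  refine norm_integral_le_of_norm_le
    ((integrable_exp_neg_mul_gaussian _ _).const_mul _).integrableOn ?_
  filter_upwards [ae_restrict_mem measurableSet_Ioi] with t ht
  have ht : 0 ≤ t := le_of_lt ht
  have h1 := (abs_integral_sin_cos_mul_hermiteFun_le ht (n + 2)).1
  have h2 := pow_mul_exp_neg_sq_le n ht
  have h3 := sq_mul_exp_neg_le k (c := Real.pi * (k + 1 / 2) - Real.pi / 4) ht (by
    nlinarith [(Nat.cast_nonneg k : (0 : ℝ) ≤ k)])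
  rw [norm_mul, Real.norm_of_nonneg (by positivity), Real.norm_eq_abs]
  calc _ ≤ 2 * Real.exp (-(Real.pi * (k + 1 / 2)) * t) *
        (t ^ (n + 2) * Real.exp (-t ^ 2 / 2)) := by gcongr
    _ = 2 * (t ^ 2 * Real.exp (-(Real.pi * (k + 1 / 2) - Real.pi / 4) * t)) *
        Real.exp (-(Real.pi / 4) * t) * (t ^ n * Real.exp (-t ^ 2 / 2)) := by
        rw [show -(Real.pi * ((k : ℝ) + 1 / 2)) * t =
          -(Real.pi * (k + 1 / 2) - Real.pi / 4) * t + -(Real.pi / 4) * t by ring, Real.exp_add]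
        ring
    _ ≤ 2 * (8 / ((k : ℝ) + 1) ^ 2) * Real.exp (-(Real.pi / 4) * t) *
        (√(n.factorial : ℝ) * Real.exp (-(t - √(n : ℝ)) ^ 2 / 2)) := by gcongr
    _ = _ := by ring

theorem summable_one_div_succ_sq : Summable (fun k : ℕ => 1 / ((k : ℝ) + 1) ^ 2) := by
  have := (summable_nat_add_iff 1).2 (Real.summable_one_div_nat_pow.2 one_lt_two)
  simpa using this

/-- The interchange is justified by the summable bound `2|x|/(k+1)²` on the pole terms, as `π(k+1/2)
≥ k+1`. -/
theorem hasSum_integral_tanh_mul_hermiteFun (n : ℕ) :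
    HasSum (fun k : ℕ => ∫ x, 2 * x / (x ^ 2 + (Real.pi * (k + 1 / 2)) ^ 2) * hermiteFun n x
        ∂(gaussianReal 0 1))
      (∫ x, Real.tanh x * hermiteFun n x ∂(gaussianReal 0 1)) := by
  have hpi := Real.two_le_pi
  have hX : Integrable (fun x : ℝ => ‖x * hermiteFun n x‖) (gaussianReal 0 1) := by
    refine ((integrable_aeval_gaussianReal (X * hermite n)).congr
      (Eventually.of_forall fun x => ?_)).norm
    simp only [map_mul, aeval_X]
  have hb (k : ℕ) (x : ℝ) :
      ‖2 * x / (x ^ 2 + (Real.pi * (k + 1 / 2)) ^ 2) * hermiteFun n x‖ ≤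
        2 / ((k : ℝ) + 1) ^ 2 * ‖x * hermiteFun n x‖ := by
    have h1 : (k : ℝ) + 1 ≤ Real.pi * (k + 1 / 2) := by
      nlinarith [(Nat.cast_nonneg k : (0 : ℝ) ≤ k)]
    have h2 : ((k : ℝ) + 1) ^ 2 ≤ x ^ 2 + (Real.pi * (k + 1 / 2)) ^ 2 :=
      (pow_le_pow_left₀ (by positivity) h1 2).trans (le_add_of_nonneg_left (sq_nonneg x))
    rw [norm_mul, norm_mul x, norm_div, norm_mul 2 x, Real.norm_of_nonneg zero_le_two,
      Real.norm_of_nonneg (r := x ^ 2 + _) (by positivity)]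
    calc _ ≤ 2 * ‖x‖ / ((k : ℝ) + 1) ^ 2 * ‖hermiteFun n x‖ := by gcongr
      _ = _ := by ring
  have hi (k : ℕ) : Integrable
      (fun x => 2 * x / (x ^ 2 + (Real.pi * (k + 1 / 2)) ^ 2) * hermiteFun n x)
      (gaussianReal 0 1) := by
    refine (hX.const_mul (2 / ((k : ℝ) + 1) ^ 2)).mono' ?_ (Eventually.of_forall (hb k))
    have := (continuous_hermiteFun n).measurable
    exact Measurable.aestronglyMeasurable (by fun_prop)
  have h := hasSum_integral_of_summable_integral_norm hi (by
    refine Summable.of_nonneg_of_le (fun k => integral_nonneg fun x => norm_nonneg _)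
      (fun k => ?_) (summable_one_div_succ_sq.mul_right
        (2 * ∫ x, ‖x * hermiteFun n x‖ ∂(gaussianReal 0 1)))
    refine (integral_mono (hi k).norm (hX.const_mul (2 / ((k : ℝ) + 1) ^ 2)) (hb k)).trans
      (le_of_eq ?_)
    rw [integral_const_mul]
    ring)
  convert! h using 2
  ext x
  exact ((hasSum_tanh x).mul_right _).tsum_eq.symm

theorem exists_mul_hermiteCoeff_tanh_sq_le :
    ∃ M : ℝ, 0 ≤ M ∧ ∀ n : ℕ, ((n + 2 : ℕ) : ℝ) * hermiteCoeff Real.tanh (n + 2) ^ 2 ≤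
      M * Real.exp (-(Real.pi * √(n : ℝ) / 2)) := by
  set K : ℝ := (∑' k : ℕ, 1 / ((k : ℝ) + 1) ^ 2) * 16 *
    (√(2 * Real.pi) * Real.exp ((Real.pi / 4) ^ 2 / 2)) with hK
  refine ⟨K ^ 2, by positivity, fun n => ?_⟩
  have h1 : |∫ x, Real.tanh x * hermiteFun (n + 2) x ∂(gaussianReal 0 1)| ≤
      K * (√(n.factorial : ℝ) * Real.exp (-(Real.pi / 4) * √(n : ℝ))) := by
    have hs := (summable_one_div_succ_sq.hasSum.mul_right (16 * √(n.factorial : ℝ) *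
        (√(2 * Real.pi) * Real.exp ((Real.pi / 4) ^ 2 / 2) *
          Real.exp (-(Real.pi / 4) * √(n : ℝ)))))
    rw [← Real.norm_eq_abs, ← (hasSum_integral_tanh_mul_hermiteFun (n + 2)).tsum_eq]
    refine (tsum_of_norm_bounded hs fun k => ?_).trans_eq ?_
    swap
    · rw [hK]; ring
    refine (abs_integral_pole_mul_hermiteFun_le n k).trans (le_of_eq (by ring))
  have h2 : (∫ x, Real.tanh x * hermiteFun (n + 2) x ∂(gaussianReal 0 1)) ^ 2 ≤
      K ^ 2 * (n.factorial * Real.exp (-(Real.pi * √(n : ℝ) / 2))) := by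
    clear_value K
    rw [← sq_abs]
    refine (pow_le_pow_left₀ (abs_nonneg _) h1 2).trans (le_of_eq ?_)
    rw [mul_pow, mul_pow, Real.sq_sqrt (by positivity), ← Real.exp_nat_mul]
    congr 3
    push_cast; ring
  rw [hermiteCoeff_eq, div_pow, Real.sq_sqrt (by positivity), ← mul_div_assoc,
    div_le_iff₀ (by positivity), Nat.factorial_succ, Nat.factorial_succ]
  have h3 : (0 : ℝ) ≤ K ^ 2 * (n.factorial * Real.exp (-(Real.pi * √(n : ℝ) / 2))) := by
    positivity
  push_cast
  calc _ ≤ ((n : ℝ) + 2) * (K ^ 2 * (n.factorial * Real.exp (-(Real.pi * √(n : ℝ) / 2)))) := by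
        gcongr
    _ ≤ ((n : ℝ) + 2) * (((n : ℝ) + 1) *
        (K ^ 2 * (n.factorial * Real.exp (-(Real.pi * √(n : ℝ) / 2))))) := by
        refine mul_le_mul_of_nonneg_left (le_mul_of_one_le_left h3 ?_) (by positivity)
        linarith [(Nat.cast_nonneg n : (0 : ℝ) ≤ n)]
    _ = _ := by ring

/-! ### The bound for the tanh kernel coefficients. -/

theorem hasDerivAt_real_tanh (x : ℝ) : HasDerivAt Real.tanh (1 / Real.cosh x ^ 2) x := by
  have h := (Real.hasDerivAt_sinh x).div (Real.hasDerivAt_cosh x) (Real.cosh_pos x).ne'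
  convert! h using 1
  · ext y; exact Real.tanh_eq_sinh_div_cosh y
  · congr 1
    linear_combination -(Real.cosh_sq_sub_sinh_sq x)

theorem abs_deriv_tanh_le_one (x : ℝ) : |deriv Real.tanh x| ≤ 1 := by
  rw [(hasDerivAt_real_tanh x).deriv, abs_of_nonneg (by positivity)]
  exact (div_le_one (by have := Real.cosh_pos x; positivity)).2
    (one_le_pow₀ (Real.one_le_cosh x))

theorem kappaTwo_tanh_isBigO (σw σb γw γb : ℝ) :
    kappaTwo Real.tanh σw σb γw γb =O[atTop]
      fun p : ℕ => Real.exp (-(Real.pi * √((p : ℝ) - 1) / 2)) := by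
  obtain ⟨M, hM, hbound⟩ := exists_mul_hermiteCoeff_tanh_sq_le
  have hder (n : ℕ) := hermiteCoeff_deriv (fun x => (hasDerivAt_real_tanh x).differentiableAt)
    (fun x => (Real.abs_tanh_lt_one x).le) abs_deriv_tanh_le_one n
  refine IsBigO.of_bound
    (σw ^ 2 * ((1 + γw ^ 2) * (M * Real.exp (Real.pi / 2)) + γb ^ 2 * M)) ?_
  filter_upwards [eventually_ge_atTop 2] with p hp
  obtain ⟨n, rfl⟩ : ∃ n, p = n + 2 := ⟨p - 2, by omega⟩
  have hpi := Real.pi_pos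
  have h0 := hder (n + 1)
  rw [show ((n + 1 : ℕ) : ℝ) + 1 = ((n + 2 : ℕ) : ℝ) by push_cast; ring] at h0
  rw [kappaTwo_succ σw σb γw γb (by omega) h0 (hder (n + 2)),
    Real.norm_of_nonneg (by positivity), Real.norm_of_nonneg (by positivity)]
  set E := Real.exp (-(Real.pi * √(((n + 2 : ℕ) : ℝ) - 1) / 2)) with hE
  have e1 : ((n + 2 : ℕ) : ℝ) - 1 = ((n + 1 : ℕ) : ℝ) := by push_cast; ring
  have hb2 : ((n + 2 + 1 : ℕ) : ℝ) * hermiteCoeff Real.tanh (n + 2 + 1) ^ 2 ≤ M * E := by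
    rw [hE, e1]
    exact hbound (n + 1)
  -- The coefficient bound gives `√(p-2)` here, not `√(p-1)`; since `√(n+1) ≤ √n + 1`, the change
  -- costs a factor `e^{π/2}`.
  have hb1 : ((n + 2 : ℕ) : ℝ) * hermiteCoeff Real.tanh (n + 2) ^ 2 ≤
      M * Real.exp (Real.pi / 2) * E := by
    refine (hbound n).trans ?_
    rw [hE, mul_assoc, ← Real.exp_add, e1]
    gcongr
    have : √((n + 1 : ℕ) : ℝ) ≤ √(n : ℝ) + 1 := by
      rw [Real.sqrt_le_left (by positivity), add_sq, Real.sq_sqrt (by positivity)]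
      push_cast
      linarith [Real.sqrt_nonneg (n : ℝ)]
    nlinarith
  have hs : hermiteCoeff Real.tanh (n + 2) ^ 2 ≤
      ((n + 2 : ℕ) : ℝ) * hermiteCoeff Real.tanh (n + 2) ^ 2 :=
    le_mul_of_one_le_left (sq_nonneg _) (by push_cast; linarith [(Nat.cast_nonneg n : (0 : ℝ) ≤ n)])
  calc _ ≤ σw ^ 2 * (M * Real.exp (Real.pi / 2) * E + γw ^ 2 * (M * Real.exp (Real.pi / 2) * E) +
        γb ^ 2 * (M * E)) := by
        gcongr
        exact hs.trans hb1
    _ = _ := by ring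

end NTK

theorem mainTheorem8 (σw σb γw γb : ℝ) (hσw : 0 < σw) (hσb : 0 ≤ σb) (hγw : 0 < γw)
    (hγb : 0 ≤ γb) :
    (NTK.kappaTwo NTK.relu σw σb γw γb =Θ[atTop]
      Set.indicator {p : ℕ | Even p ∨ 0 < γb} (fun p : ℕ => (p : ℝ) ^ (-(3 / 2) : ℝ))) ∧
    (NTK.kappaTwo Real.tanh σw σb γw γb =O[atTop]
      fun p : ℕ => Real.exp (-(Real.pi * √((p : ℝ) - 1) / 2))) ∧
    (∀ σ : ℝ, 0 < σ →
      NTK.kappaTwo (NTK.gaussianActivation σ) σw σb γw γb =Θ[atTop]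
        Set.indicator {p : ℕ | Even p ∨ 0 < γb}
          (fun p : ℕ => (p : ℝ) ^ (1 / 2 : ℝ) * ((σ ^ 2 + 1) ^ p)⁻¹)) :=
  ⟨NTK.kappaTwo_relu_isTheta σb hσw hγw hγb, NTK.kappaTwo_tanh_isBigO σw σb γw γb,
    fun _ hσ => NTK.kappaTwo_gaussianActivation_isTheta σb hσw hγw hγb hσ⟩
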